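/- Let $z\in\mathbb{C}$ and let $\alpha,\beta>0$ with $\alpha\beta=1$. Put $$\operatorname{erf}(z)=\frac{2}{\sqrt\pi}\int_0^z e^{-w^2}\,dw,\qquad \operatorname{erfi}(z)=\frac{2}{\sqrt\pi}\int_0^z e^{w^2}\,dw,$$ $$\xi(s)=\tfrac12 s(s-1)\pi^{-s/2}\Gamma\left(\tfrac s2\right)\zeta(s),\qquad \Xi(t)=\xi\left(\tfrac12+it\right),$$ and, with Kummer's confluent hypergeometric function ${}_1F_1(a;c;w)=\sum_{n\ge 0}\frac{(a)_n}{(c)_n}\frac{w^n}{n!}$, $$\omega(x,z,s)=x^{\frac12-s}e^{-z^2/8}\,{}_1F_1\left(1-\tfrac s2;\tfrac32;\tfrac{z^2}{4}\right),\qquad \Delta(x,z,s)=\omega(x,z,s)+\omega(x,z,1-s).$$ Then the three integrals below converge absolutely, and $$\begin{aligned} &\sqrt{\alpha}\,e^{z^2/8}\left(\operatorname{erf}\left(\frac z2\right)-4\int_0^\infty\frac{e^{-\pi\alpha^2x^2}\sin(\sqrt\pi\,\alpha xz)}{e^{2\pi x}-1}\,dx\right)\\ &=\sqrt{\beta}\,e^{-z^2/8}\left(\operatorname{erfi}\left(\frac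 z2\right)-4\int_0^\infty\frac{e^{-\pi\beta^2x^2}\sinh(\sqrt\pi\,\beta xz)}{e^{2\pi x}-1}\,dx\right)\\ &=\frac{z}{8\pi^2}\int_0^\infty\Gamma\left(\frac{-1+it}{4}\right)\Gamma\left(\frac{-1-it}{4}\right)\Xi\left(\frac t2\right)\Delta\left(\alpha,z,\frac{1+it}{2}\right)dt. \end{aligned}$$ -/

import Mathlib

open MeasureTheory Set

noncomputable section

namespace ErfTransformation

/-- The error function `erf z = (2/√π) ∫₀ᶻ e^{-w²} dw` of a complex argument; the (entire) integrand
is integrated along the segment `w = u z`, `0 ≤ u ≤ 1`. -/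
def erf (z : ℂ) : ℂ :=
  2 / (Real.sqrt Real.pi : ℂ) * (z * ∫ u in (0 : ℝ)..1, Complex.exp (-((u : ℂ) * z) ^ 2))

/-- The imaginary error function `erfi z = (2/√π) ∫₀ᶻ e^{w²} dw` of a complex argument; the (entire)
integrand is integrated along the segment `w = u z`, `0 ≤ u ≤ 1`. -/
def erfi (z : ℂ) : ℂ :=
  2 / (Real.sqrt Real.pi : ℂ) * (z * ∫ u in (0 : ℝ)..1, Complex.exp (((u : ℂ) * z) ^ 2))

/-- Riemann's function `ξ(s) = ½ s (s - 1) π^{-s/2} Γ(s/2) ζ(s)`. It is only evaluated on the line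
`Re s = 1/2`, where none of the factors has a pole. -/
def xi (s : ℂ) : ℂ :=
  1 / 2 * s * (s - 1) * (Real.pi : ℂ) ^ (-s / 2) * Complex.Gamma (s / 2) * riemannZeta s

/-- Riemann's function `Ξ(t) = ξ(1/2 + i t)` for real `t`. -/
def Xi (t : ℝ) : ℂ := xi (1 / 2 + Complex.I * t)

/-- Kummer's confluent hypergeometric function
`₁F₁(a; c; z) = ∑ₙ (a)ₙ / (c)ₙ · zⁿ / n!`, where `c` is not a non-positive integer. Mathlib's
regularized function has the coefficients `(a)ₙ / (Γ(c + n) n!)`. -/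
def kummer (a c z : ℂ) : ℂ := Complex.Gamma c * Complex.regularizedHGFun {a} {c} z

theorem kummer_eq_tsum (a c z : ℂ) (hc : ∀ k : ℕ, c ≠ -k) :
    kummer a c z = ∑' n : ℕ, (ascPochhammer ℂ n).eval a / (ascPochhammer ℂ n).eval c * z ^ n /
      (n.factorial : ℂ) := by
  rw [kummer, Complex.regularizedHGFun, Complex.regularizedHGFunSeries,
    FormalMultilinearSeries.sum, ← tsum_mul_left]
  refine tsum_congr fun n => ?_
  have h0 : Complex.Gamma c ≠ 0 := Complex.Gamma_ne_zero hc
  have h := Complex.Gamma_add_nat_div_Gamma_eq (n := n) c hc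
  rw [div_eq_iff h0] at h
  simp only [FormalMultilinearSeries.ofScalars_apply_eq, Complex.regularizedHGFunCoeff,
    Multiset.map_singleton, Multiset.prod_singleton, h,
    smul_eq_mul]
  field_simp

/-- `ω(x, z, s) = x^{1/2 - s} e^{-z²/8} ₁F₁(1 - s/2; 3/2; z²/4)`, for `x > 0`. -/
def omega (x : ℝ) (z s : ℂ) : ℂ :=
  (x : ℂ) ^ (1 / 2 - s) * Complex.exp (-z ^ 2 / 8) * kummer (1 - s / 2) (3 / 2) (z ^ 2 / 4)

/-- `Δ(x, z, s) = ω(x, z, s) + ω(x, z, 1 - s)`. -/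
def Delta (x : ℝ) (z s : ℂ) : ℂ := omega x z s + omega x z (1 - s)

/-- The integrand `e^{-πα²x²} sin(√π α x z) / (e^{2πx} - 1)`. -/
def sinIntegrand (α : ℝ) (z : ℂ) (x : ℝ) : ℂ :=
  Complex.exp (-Real.pi * α ^ 2 * x ^ 2) * Complex.sin (Real.sqrt Real.pi * α * x * z) /
    (Complex.exp (2 * Real.pi * x) - 1)

/-- The integrand `e^{-πβ²x²} sinh(√π β x z) / (e^{2πx} - 1)`. -/
def sinhIntegrand (β : ℝ) (z : ℂ) (x : ℝ) : ℂ :=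
  Complex.exp (-Real.pi * β ^ 2 * x ^ 2) * Complex.sinh (Real.sqrt Real.pi * β * x * z) /
    (Complex.exp (2 * Real.pi * x) - 1)

/-- The integrand `Γ((-1 + i t)/4) Γ((-1 - i t)/4) Ξ(t/2) Δ(α, z, (1 + i t)/2)`. -/
def xiIntegrand (α : ℝ) (z : ℂ) (t : ℝ) : ℂ :=
  Complex.Gamma ((-1 + Complex.I * t) / 4) * Complex.Gamma ((-1 - Complex.I * t) / 4) *
    Xi (t / 2) * Delta α z ((1 + Complex.I * t) / 2)

end ErfTransformation

end

/-!
Write `f(x) = 1 / (e^{2πx} - 1) - 1 / (2πx)` and `g(x) = exp (-πα²x²) sin (√π α z x)`.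

The singular part of `f` accounts for the error function: `∫ g(x) / (2πx) dx = erf (z/2) / 4`, a
Mellin transform evaluated at `0` (`integral_gaussSin_div`). Hence the first expression equals
`-4 √α e^{z²/8} ∫ f g`. By Mellin inversion of `g` and Fubini's theorem (`mellin_fubini`), `∫ f g`
is `1 / (2πi)` times the integral over `Re s = 1/2` of the Mellin transform of `f` at `1 - s` times
that of `g` at `s`:

* the transform of `f` is `(2π)^{-s} Γ(s) ζ(s)` in the critical strip, by analytic continuation from
  `Re s > 1` after a cut-off of the singularity (`hasMellin_boseKernel`); the functional equation
  and the duplication formula turn its value at `1 - s` into `ξ(s)` times Gamma factors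
  (`mul_mellin_boseKernel_one_sub`);
* the transform of `g` is `z` times a power times `Γ((s+1)/2) ₁F₁((s+1)/2; 3/2; -z²/4)`, by termwise
  integration of the sine series (`mellin_gaussSin`). Two integrations by parts show that it is
  integrable on vertical lines (`verticalIntegrable_mellin_gaussExp`), which is what inversion,
  Fubini and the absolute convergence of the third integral need.

With Kummer's transformation (`exp_neg_mul_kummer`) the product is `z` times, up to a constant
factor, the integrand with `ω` in place of `Δ`, over the whole line (`halfXiIntegrand_eq`);
folding the line at `0` replaces `ω` by `Δ`. So the first and the third expression agree
(`sinIntegrand_identity`). The second expression is `-i` times the first one at `(β, iz)`, and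
Kummer's transformation once more shows that `Δ(β, iz, s) = Δ(α, z, s)` (`omega_I_mul`), so it
equals the third expression as well.
-/

namespace ErfTransformation

open Filter Topology Asymptotics

/-! ### Kummer's transformation -/

theorem ascPochhammer_eval_succ_left (n : ℕ) (a : ℂ) :
    (ascPochhammer ℂ (n + 1)).eval a = a * (ascPochhammer ℂ n).eval (a + 1) := by
  simp [ascPochhammer_succ_left, Polynomial.eval_comp]

theorem ascPochhammer_eval_ne_zero {c : ℂ} (hc : ∀ k : ℕ, c ≠ -k) (n : ℕ) :
    (ascPochhammer ℂ n).eval c ≠ 0 := by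
  induction n with
  | zero => simp
  | succ n ih =>
    rw [ascPochhammer_succ_eval]
    exact mul_ne_zero ih fun h => hc n (eq_neg_of_add_eq_zero_left h)

/-- The Chu–Vandermonde identity `₂F₁(-n, a; c; 1) = (c - a)ₙ / (c)ₙ`. -/
theorem sum_choose_mul_ascPochhammer_div (n : ℕ) (a c : ℂ) (hc : ∀ k : ℕ, c ≠ -k) :
    ∑ k ∈ Finset.range (n + 1), (n.choose k : ℂ) *
      ((-1) ^ k * ((ascPochhammer ℂ k).eval a / (ascPochhammer ℂ k).eval c)) =
      (ascPochhammer ℂ n).eval (c - a) / (ascPochhammer ℂ n).eval c := by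
  induction n generalizing a c with
  | zero => simp
  | succ n ih =>
    have hc' : ∀ k : ℕ, c + 1 ≠ -k := fun k h => hc (k + 1) (by push_cast; linear_combination h)
    have hc0 : c ≠ 0 := by simpa using hc 0
    rw [Finset.sum_choose_succ_mul
      (fun i _ => (-1) ^ i * ((ascPochhammer ℂ i).eval a / (ascPochhammer ℂ i).eval c)) n,
      ih a c hc]
    have h2 : ∑ i ∈ Finset.range (n + 1), (n.choose i : ℂ) * ((-1) ^ (i + 1) *
        ((ascPochhammer ℂ (i + 1)).eval a / (ascPochhammer ℂ (i + 1)).eval c)) =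
        -(a / c) * ((ascPochhammer ℂ n).eval (c - a) / (ascPochhammer ℂ n).eval (c + 1)) := by
      have := ih (a + 1) (c + 1) hc'
      rw [show c + 1 - (a + 1) = c - a by ring] at this
      rw [← this, Finset.mul_sum]
      refine Finset.sum_congr rfl fun i _ => ?_
      rw [ascPochhammer_eval_succ_left, ascPochhammer_eval_succ_left, pow_succ, mul_div_mul_comm]
      ring
    rw [h2]
    have h3 := ascPochhammer_eval_ne_zero hc n
    have h4 := ascPochhammer_eval_ne_zero hc' n
    have h5 : c + n ≠ 0 := fun h => hc n (eq_neg_of_add_eq_zero_left h)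
    have h6 : c * (ascPochhammer ℂ n).eval (c + 1) = (ascPochhammer ℂ n).eval c * (c + n) := by
      rw [← ascPochhammer_eval_succ_left, ascPochhammer_succ_eval]
    rw [ascPochhammer_succ_eval, ascPochhammer_succ_eval]
    have h7 : (a / c) * ((ascPochhammer ℂ n).eval (c - a) / (ascPochhammer ℂ n).eval (c + 1)) =
        a * (ascPochhammer ℂ n).eval (c - a) / ((ascPochhammer ℂ n).eval c * (c + n)) := by
      rw [← h6, div_mul_div_comm]
    rw [neg_mul, h7]
    field_simp
    ring

theorem summable_norm_kummer (a c z : ℂ) (hc : ∀ k : ℕ, c ≠ -k) :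
    Summable fun n : ℕ => ‖(ascPochhammer ℂ n).eval a / (ascPochhammer ℂ n).eval c * z ^ n /
      (n.factorial : ℂ)‖ := by
  have h0 : Complex.Gamma c ≠ 0 := Complex.Gamma_ne_zero hc
  have hr : (Complex.regularizedHGFunSeries {a} {c}).radius = ⊤ :=
    Complex.radius_regularizedHGFunSeries_eq_top (by simp)
  have hs := ((Complex.regularizedHGFunSeries {a} {c}).summable_norm_apply
    (x := z) (by simp [hr])).mul_left ‖Complex.Gamma c‖
  refine hs.congr fun n => ?_
  rw [← norm_mul]
  congr 1
  have h := Complex.Gamma_add_nat_div_Gamma_eq (n := n) c hc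
  rw [div_eq_iff h0] at h
  simp only [Complex.regularizedHGFunSeries, FormalMultilinearSeries.ofScalars_apply_eq,
    Complex.regularizedHGFunCoeff,
    Multiset.map_singleton, Multiset.prod_singleton, h, smul_eq_mul]
  field_simp

/-- Kummer's first transformation `e^{-z} ₁F₁(a; c; z) = ₁F₁(c - a; c; -z)`. -/
theorem exp_neg_mul_kummer (a c z : ℂ) (hc : ∀ k : ℕ, c ≠ -k) :
    Complex.exp (-z) * kummer a c z = kummer (c - a) c (-z) := by
  have hexp : Complex.exp (-z) = ∑' n : ℕ, (-z) ^ n / (n.factorial : ℂ) := by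
    rw [Complex.exp_eq_exp_ℂ, NormedSpace.exp_eq_tsum_div]
  have hes : Summable fun n : ℕ => ‖(-z) ^ n / (n.factorial : ℂ)‖ :=
    NormedSpace.norm_expSeries_div_summable (𝔸 := ℂ) (-z)
  rw [mul_comm, hexp, kummer_eq_tsum a c z hc, kummer_eq_tsum (c - a) c (-z) hc,
    tsum_mul_tsum_eq_tsum_sum_range_of_summable_norm (summable_norm_kummer a c z hc) hes]
  refine tsum_congr fun n => ?_
  rw [← sum_choose_mul_ascPochhammer_div n a c hc, Finset.sum_mul, Finset.sum_div]
  refine Finset.sum_congr rfl fun k hk => ?_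
  have hk' : k ≤ n := Nat.lt_succ_iff.mp (Finset.mem_range.mp hk)
  have hn : (-z) ^ n = (-z) ^ (n - k) * (-1) ^ k * z ^ k := by
    rw [mul_assoc, ← mul_pow, neg_one_mul, ← pow_add, Nat.sub_add_cancel hk']
  have hsq : ((-1 : ℂ) ^ k) * (-1) ^ k = 1 := by rw [← mul_pow]; simp
  rw [Nat.cast_choose ℂ hk', hn]
  have h1 : (n.factorial : ℂ) ≠ 0 := by exact_mod_cast n.factorial_ne_zero
  have h2 : (k.factorial : ℂ) ≠ 0 := by exact_mod_cast k.factorial_ne_zero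
  have h3 : ((n - k).factorial : ℂ) ≠ 0 := by exact_mod_cast (n - k).factorial_ne_zero
  have h4 := ascPochhammer_eval_ne_zero hc k
  field_simp
  linear_combination (- (-z) ^ (n - k) * z ^ k * (ascPochhammer ℂ k).eval a) * hsq

/-! ### The Mellin transform of `exp (-a x² + c x)` -/

/-- The function `x ↦ exp (-a x² + c x)`. -/
noncomputable def gaussExp (a : ℝ) (c : ℂ) (x : ℝ) : ℂ := Complex.exp (-a * (x : ℂ) ^ 2 + c * x)

theorem continuous_gaussExp (a : ℝ) (c : ℂ) : Continuous (gaussExp a c) := by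
  unfold gaussExp; fun_prop

theorem gaussExp_isLittleO_atTop {a : ℝ} (ha : 0 < a) (c : ℂ) (r : ℝ) :
    gaussExp a c =o[atTop] (fun x : ℝ => x ^ r) :=
  cexp_neg_quadratic_isLittleO_rpow_atTop (a := -(a : ℂ)) (by simpa using ha) c r

theorem gaussExp_isBigO_nhdsGT_zero (a : ℝ) (c : ℂ) :
    gaussExp a c =O[𝓝[>] 0] (fun x : ℝ => x ^ (-(0 : ℝ))) := by
  simp only [neg_zero, Real.rpow_zero]
  exact ((continuous_gaussExp a c).tendsto 0).isBigO_one ℝ |>.mono nhdsWithin_le_nhds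

theorem mellin_gaussExp_regular {a : ℝ} (ha : 0 < a) (c : ℂ) {s : ℂ} (hs : 0 < s.re) :
    MellinConvergent (gaussExp a c) s ∧ DifferentiableAt ℂ (mellin (gaussExp a c)) s := by
  have hl : LocallyIntegrableOn (gaussExp a c) (Ioi 0) :=
    (continuous_gaussExp a c).continuousOn.locallyIntegrableOn measurableSet_Ioi
  exact ⟨mellinConvergent_of_isBigO_rpow hl (gaussExp_isLittleO_atTop ha c _).isBigO
      (lt_add_one s.re) (gaussExp_isBigO_nhdsGT_zero a c) hs,
    mellin_differentiableAt_of_isBigO_rpow hl (gaussExp_isLittleO_atTop ha c _).isBigO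
      (lt_add_one s.re) (gaussExp_isBigO_nhdsGT_zero a c) hs⟩

/-- Integration by parts for the Mellin transform of `exp (-a x² + c x)`. -/
theorem mul_mellin_gaussExp {a : ℝ} (ha : 0 < a) (c : ℂ) {s : ℂ} (hs : 0 < s.re) :
    s * mellin (gaussExp a c) s =
      2 * a * mellin (gaussExp a c) (s + 2) - c * mellin (gaussExp a c) (s + 1) := by
  have hs0 : s ≠ 0 := by rintro rfl; simp at hs
  have c0 := (mellin_gaussExp_regular ha c hs).1
  have c1 := (mellin_gaussExp_regular ha c (s := s + 1) (by simp; linarith)).1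
  have c2 := (mellin_gaussExp_regular ha c (s := s + 2) (by simp; linarith)).1
  simp only [MellinConvergent, smul_eq_mul] at c0 c1 c2
  have c01 : IntegrableOn (fun x : ℝ => s * ((x : ℂ) ^ (s - 1) * gaussExp a c x) +
      c * ((x : ℂ) ^ (s + 1 - 1) * gaussExp a c x)) (Ioi 0) := (c0.const_mul s).add (c1.const_mul c)
  have hint := c01.sub (c2.const_mul (2 * a))
  have hderiv : ∀ x ∈ Ioi (0 : ℝ), HasDerivAt (fun x : ℝ => (x : ℂ) ^ s * gaussExp a c x)
      (s * ((x : ℂ) ^ (s - 1) * gaussExp a c x) + c * ((x : ℂ) ^ (s + 1 - 1) * gaussExp a c x) -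
        2 * a * ((x : ℂ) ^ (s + 2 - 1) * gaussExp a c x)) x := by
    intro x hx
    have hx0 : (x : ℂ) ≠ 0 := Complex.ofReal_ne_zero.mpr (ne_of_gt hx)
    have h1 : HasDerivAt (fun x : ℝ => (x : ℂ) ^ s) (s * (x : ℂ) ^ (s - 1)) x := by
      simpa using (hasDerivAt_id (x : ℂ)).cpow_const
        (c := s) (Or.inl (by simpa using hx)) |>.comp_ofReal
    have h2 : HasDerivAt (fun w : ℂ => Complex.exp (-a * w ^ 2 + c * w))
        (Complex.exp (-a * (x : ℂ) ^ 2 + c * x) * (-a * (2 * x) + c)) (x : ℂ) := by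
      have := (((hasDerivAt_pow 2 (x : ℂ)).const_mul (-a : ℂ)).add
        ((hasDerivAt_id (x : ℂ)).const_mul c)).cexp
      simpa using! this
    have h3 : HasDerivAt (gaussExp a c) (gaussExp a c x * (-a * (2 * x) + c)) x := h2.comp_ofReal
    refine (h1.mul h3).congr_deriv ?_
    have e1 : (x : ℂ) ^ (s + 2 - 1) = (x : ℂ) ^ s * x := by
      rw [show s + 2 - 1 = s + 1 by ring, Complex.cpow_add _ _ hx0, Complex.cpow_one]
    rw [e1, add_sub_cancel_right]
    ring
  have hcont : ContinuousWithinAt (fun x : ℝ => (x : ℂ) ^ s * gaussExp a c x) (Ici 0) 0 :=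
    ((Complex.continuousAt_ofReal_cpow 0 s (Or.inl hs)).comp
      (f := fun x : ℝ => (x, s)) (by fun_prop)).continuousWithinAt.mul
      (continuous_gaussExp a c).continuousWithinAt
  have htop : Tendsto (fun x : ℝ => (x : ℂ) ^ s * gaussExp a c x) atTop (𝓝 0) := by
    have h : (fun x : ℝ => (x : ℂ) ^ s * gaussExp a c x) =o[atTop]
        (fun x : ℝ => x ^ s.re * x ^ (-s.re)) := by
      refine IsBigO.mul_isLittleO ?_ (gaussExp_isLittleO_atTop ha c _)
      refine IsBigO.of_bound 1 ?_
      filter_upwards [eventually_gt_atTop 0] with x hx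
      rw [Complex.norm_cpow_eq_rpow_re_of_pos hx, one_mul]
      exact le_abs_self _
    refine (isLittleO_one_iff ℝ).mp (h.trans_isBigO (IsBigO.of_bound 1 ?_))
    filter_upwards [eventually_gt_atTop 0] with x hx
    rw [← Real.rpow_add hx]
    simp
  have key := integral_Ioi_of_hasDerivAt_of_tendsto hcont hderiv hint htop
  rw [integral_sub c01 (c2.const_mul (2 * a)),
    integral_add (c0.const_mul s) (c1.const_mul c)] at key
  simp only [integral_const_mul, Complex.ofReal_zero, Complex.zero_cpow hs0] at key
  simp only [mellin, smul_eq_mul]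
  linear_combination key

theorem norm_mellin_le (f : ℝ → ℂ) (s : ℂ) :
    ‖mellin f s‖ ≤ ∫ x in Ioi (0 : ℝ), x ^ (s.re - 1) * ‖f x‖ := by
  refine (norm_integral_le_integral_norm _).trans_eq ?_
  refine setIntegral_congr_fun measurableSet_Ioi fun x hx => ?_
  simp [Complex.norm_cpow_eq_rpow_re_of_pos hx]

/-- Two integrations by parts show that the Mellin transform of `exp (-a x² + c x)` is
`O(1 / |s|²)` on vertical lines, hence integrable there. -/
theorem verticalIntegrable_mellin_gaussExp {a : ℝ} (ha : 0 < a) (c : ℂ) {σ : ℝ} (hσ : 0 < σ) :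
    Complex.VerticalIntegrable (mellin (gaussExp a c)) σ := by
  set M := mellin (gaussExp a c) with hM
  let B : ℝ → ℝ := fun r => ∫ x in Ioi (0 : ℝ), x ^ (r - 1) * ‖gaussExp a c x‖
  have hB : ∀ s : ℂ, ‖M s‖ ≤ B s.re := fun s => norm_mellin_le _ s
  obtain ⟨C, hC⟩ : ∃ C : ℝ, ∀ s : ℂ, s.re = σ → ‖s * (s + 1) * M s‖ ≤ C := by
    refine ⟨‖c ^ 2‖ * B (σ + 2) + ‖4 * (a : ℂ) * c‖ * B (σ + 3) + ‖4 * (a : ℂ) ^ 2‖ * B (σ + 4) +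
      ‖2 * (a : ℂ)‖ * B (σ + 2), fun s hs => ?_⟩
    have r0 := mul_mellin_gaussExp ha c (s := s) (by linarith)
    have r1 := mul_mellin_gaussExp ha c (s := s + 1) (by simp; linarith)
    have r2 := mul_mellin_gaussExp ha c (s := s + 2) (by simp; linarith)
    rw [show s + 1 + 2 = s + 3 by ring, show s + 1 + 1 = s + 2 by ring] at r1
    rw [show s + 2 + 2 = s + 4 by ring, show s + 2 + 1 = s + 3 by ring] at r2
    rw [← hM] at r0 r1 r2
    -- Applying the recursion at `s`, `s + 1` and `s + 2` leaves no factor `s` on the right.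
    have e : s * (s + 1) * M s = c ^ 2 * M (s + 2) - 4 * a * c * M (s + 3) +
        4 * a ^ 2 * M (s + 4) - 2 * a * M (s + 2) := by
      linear_combination (s + 1) * r0 - c * r1 + 2 * a * r2
    rw [e]
    have b2 := hB (s + 2)
    have b3 := hB (s + 3)
    have b4 := hB (s + 4)
    rw [show (s + 2).re = σ + 2 by simp [hs]] at b2
    rw [show (s + 3).re = σ + 3 by simp [hs]] at b3
    rw [show (s + 4).re = σ + 4 by simp [hs]] at b4
    refine (norm_sub_le _ _).trans (add_le_add ((norm_add_le _ _).trans (add_le_add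
      ((norm_sub_le _ _).trans (add_le_add ?_ ?_)) ?_)) ?_) <;>
    · rw [norm_mul]
      gcongr
  have hcont : Continuous fun y : ℝ => M (σ + y * Complex.I) := by
    rw [continuous_iff_continuousAt]
    intro y
    have hd := (mellin_gaussExp_regular ha c (s := σ + y * Complex.I) (by simpa)).2.continuousAt
    exact hd.comp (f := fun y : ℝ => (σ + y * Complex.I : ℂ)) (by fun_prop)
  refine (integrable_inv_one_add_sq.const_mul (C * (1 + (σ ^ 2)⁻¹))).mono'
    hcont.aestronglyMeasurable (ae_of_all _ fun y => ?_)
  set s : ℂ := σ + y * Complex.I with hs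
  have hre : s.re = σ := by simp [hs]
  have him : s.im = y := by simp [hs]
  have h1 : σ ^ 2 + y ^ 2 ≤ ‖s * (s + 1)‖ := by
    have e1 : ‖s‖ ^ 2 = σ ^ 2 + y ^ 2 := by
      rw [Complex.sq_norm, Complex.normSq_apply, hre, him]; ring
    have e2 : ‖s‖ ≤ ‖s + 1‖ := by
      refine le_of_sq_le_sq ?_ (norm_nonneg _)
      rw [Complex.sq_norm, Complex.sq_norm, Complex.normSq_apply, Complex.normSq_apply]
      simp only [Complex.add_re, Complex.add_im, Complex.one_re, Complex.one_im, hre]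
      nlinarith
    rw [norm_mul, ← e1, sq]
    gcongr
  have h2 := hC s hre
  rw [norm_mul] at h2
  have h3 : (σ ^ 2 + y ^ 2) * ‖M s‖ ≤ C := (mul_le_mul_of_nonneg_right h1 (norm_nonneg _)).trans h2
  have hσ2 : 0 < σ ^ 2 := by positivity
  have h4 : 1 + y ^ 2 ≤ (1 + (σ ^ 2)⁻¹) * (σ ^ 2 + y ^ 2) := by
    have : (1 + (σ ^ 2)⁻¹) * (σ ^ 2 + y ^ 2) = 1 + y ^ 2 + σ ^ 2 + (σ ^ 2)⁻¹ * y ^ 2 := by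
      field_simp; ring
    rw [this]
    have : 0 ≤ (σ ^ 2)⁻¹ * y ^ 2 := by positivity
    linarith
  rw [← div_eq_mul_inv, le_div_iff₀ (by positivity)]
  calc ‖M s‖ * (1 + y ^ 2) ≤ ‖M s‖ * ((1 + (σ ^ 2)⁻¹) * (σ ^ 2 + y ^ 2)) := by gcongr
    _ = (1 + (σ ^ 2)⁻¹) * ((σ ^ 2 + y ^ 2) * ‖M s‖) := by ring
    _ ≤ (1 + (σ ^ 2)⁻¹) * C := by gcongr
    _ = C * (1 + (σ ^ 2)⁻¹) := mul_comm _ _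

/-! ### The Mellin transform of `exp (-a x²) sin (b x)` -/

/-- The function `x ↦ exp (-a x²) sin (b x)`. -/
noncomputable def gaussSin (a : ℝ) (b : ℂ) (x : ℝ) : ℂ :=
  Complex.exp (-a * (x : ℂ) ^ 2) * Complex.sin (b * x)

theorem continuous_gaussSin (a : ℝ) (b : ℂ) : Continuous (gaussSin a b) := by
  unfold gaussSin; fun_prop

theorem gaussSin_eq_gaussExp (a : ℝ) (b : ℂ) (x : ℝ) :
    gaussSin a b x = Complex.I / 2 * gaussExp a (-b * Complex.I) x -
      Complex.I / 2 * gaussExp a (b * Complex.I) x := by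
  simp only [gaussSin, gaussExp, Complex.sin, Complex.exp_add]
  rw [show -(b * (x : ℂ)) * Complex.I = -b * Complex.I * x by ring,
    show b * (x : ℂ) * Complex.I = b * Complex.I * x by ring]
  ring

theorem gaussSin_isBigO_nhdsGT_zero (a : ℝ) (b : ℂ) :
    gaussSin a b =O[𝓝[>] 0] (fun x : ℝ => x ^ (-(-1 : ℝ))) := by
  simp only [neg_neg, Real.rpow_one]
  have h : DifferentiableAt ℝ (gaussSin a b) 0 := by
    have hd : DifferentiableAt ℂ (fun x : ℂ => Complex.exp (-a * x ^ 2) * Complex.sin (b * x))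
        ((0 : ℝ) : ℂ) := by fun_prop
    exact hd.hasDerivAt.comp_ofReal.differentiableAt
  have := h.isBigO_sub
  simp only [sub_zero] at this
  rw [show gaussSin a b 0 = 0 by simp [gaussSin]] at this
  simpa using this.mono nhdsWithin_le_nhds

theorem mellinConvergent_gaussSin {a : ℝ} (ha : 0 < a) (b : ℂ) {s : ℂ} (hs : -1 < s.re) :
    MellinConvergent (gaussSin a b) s := by
  refine mellinConvergent_of_isBigO_rpow
    ((continuous_gaussSin a b).continuousOn.locallyIntegrableOn measurableSet_Ioi) ?_
    (lt_add_one s.re) (gaussSin_isBigO_nhdsGT_zero a b) hs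
  simp_rw [funext (gaussSin_eq_gaussExp a b)]
  exact ((gaussExp_isLittleO_atTop ha _ _).isBigO.const_mul_left _).sub
    ((gaussExp_isLittleO_atTop ha _ _).isBigO.const_mul_left _)

theorem verticalIntegrable_mellin_gaussSin {a : ℝ} (ha : 0 < a) (b : ℂ) {σ : ℝ} (hσ : 0 < σ) :
    Complex.VerticalIntegrable (mellin (gaussSin a b)) σ := by
  refine (((verticalIntegrable_mellin_gaussExp ha (-b * Complex.I) hσ).const_mul
    (Complex.I / 2)).sub ((verticalIntegrable_mellin_gaussExp ha (b * Complex.I) hσ).const_mul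
    (Complex.I / 2))).congr (ae_of_all _ fun y => ?_)
  have hs : 0 < ((σ : ℂ) + y * Complex.I).re := by simpa
  have h := (hasMellin_sub
    ((mellin_gaussExp_regular ha (-b * Complex.I) hs).1.const_smul (Complex.I / 2))
    ((mellin_gaussExp_regular ha (b * Complex.I) hs).1.const_smul (Complex.I / 2))).2
  rw [mellin_const_smul, mellin_const_smul] at h
  simp only [smul_eq_mul] at h
  simp_rw [Pi.sub_apply, funext (gaussSin_eq_gaussExp a b), h]

/-- The moments of the Gaussian, reduced to the Gamma integral by substituting `t = x²`. -/
theorem mellin_exp_neg_mul_sq {a : ℝ} (ha : 0 < a) {s : ℂ} (hs : 0 < s.re) :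
    ∫ x in Ioi (0 : ℝ), (x : ℂ) ^ (s - 1) * Complex.exp (-a * (x : ℂ) ^ 2) =
      1 / 2 * ((a : ℂ) ^ (-(s / 2)) * Complex.Gamma (s / 2)) := by
  have h := mellin_comp_rpow (fun t : ℝ => Complex.exp (-(a * t))) s 2
  simp only [mellin, smul_eq_mul, Real.rpow_two, Complex.ofReal_pow] at h
  simp_rw [neg_mul]
  rw [h, Complex.ofReal_ofNat, Complex.integral_cpow_mul_exp_neg_mul_Ioi (by simpa) (by simpa),
    one_div (a : ℂ), Complex.inv_cpow _ _
      (by simp [Complex.arg_ofReal_of_nonneg ha.le, Real.pi_ne_zero.symm]), Complex.cpow_neg]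
  simp

/-- At an imaginary frequency the Gaussian sine is, in norm, a Gaussian times `sinh`; it dominates
the power series of `exp (-a x²) sin (b x)` for `|b| = r`. -/
theorem norm_gaussSin_mul_I (a r x : ℝ) :
    ‖gaussSin a (r * Complex.I) x‖ = Real.exp (-a * x ^ 2) * |Real.sinh (r * x)| := by
  rw [gaussSin, show (r : ℂ) * Complex.I * x = ((r * x : ℝ) : ℂ) * Complex.I by push_cast; ring,
    Complex.sin_mul_I, norm_mul, norm_mul, Complex.norm_I, mul_one, ← Complex.ofReal_sinh,
    Complex.norm_real, Complex.norm_exp, Real.norm_eq_abs]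
  congr 2
  norm_cast

theorem factorial_two_mul_add_one (k : ℕ) :
    ((2 * k + 1).factorial : ℂ) =
      4 ^ k * k.factorial * (ascPochhammer ℂ k).eval (3 / 2 : ℂ) := by
  induction k with
  | zero => simp
  | succ k ih =>
    rw [show 2 * (k + 1) + 1 = (2 * k + 1) + 1 + 1 by ring, Nat.factorial_succ, Nat.factorial_succ,
      Nat.cast_mul, Nat.cast_mul, ih, ascPochhammer_succ_eval, Nat.factorial_succ]
    push_cast
    ring

theorem three_halves_ne_neg (k : ℕ) : (3 / 2 : ℂ) ≠ -k := by
  intro h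
  have := congrArg Complex.re h
  norm_num at this
  have hk : (0 : ℝ) ≤ k := k.cast_nonneg
  linarith

/-- The Mellin transform of `exp (-a x²) sin (b x)`, computed by integrating the power series of
the sine term by term. -/
theorem mellin_gaussSin {a : ℝ} (ha : 0 < a) (b : ℂ) {s : ℂ} (hs : -1 < s.re) :
    mellin (gaussSin a b) s = b / 2 * (a : ℂ) ^ (-((s + 1) / 2)) * Complex.Gamma ((s + 1) / 2) *
      kummer ((s + 1) / 2) (3 / 2) (-b ^ 2 / (4 * a)) := by
  have ha0 : (a : ℂ) ≠ 0 := by exact_mod_cast ha.ne'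
  let F : ℕ → ℝ → ℂ := fun k x => (x : ℂ) ^ (s - 1) *
    (Complex.exp (-a * (x : ℂ) ^ 2) * ((-1) ^ k * (b * x) ^ (2 * k + 1) / (2 * k + 1).factorial))
  let bound : ℕ → ℝ → ℝ := fun k x => x ^ (s.re - 1) *
    (Real.exp (-a * x ^ 2) * ((‖b‖ * x) ^ (2 * k + 1) / (2 * k + 1).factorial))
  have hbs : ∀ x : ℝ, HasSum (fun k => bound k x)
      (x ^ (s.re - 1) * (Real.exp (-a * x ^ 2) * Real.sinh (‖b‖ * x))) := fun x =>
    ((Real.hasSum_sinh (‖b‖ * x)).mul_left _).mul_left _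
  have hmain : HasSum (fun k => ∫ x in Ioi (0 : ℝ), F k x) (mellin (gaussSin a b) s) := by
    refine hasSum_integral_of_dominated_convergence bound (fun k => ?_) (fun k => ?_)
      (ae_of_all _ fun x => (hbs x).summable) ?_ ?_
    · refine ContinuousOn.aestronglyMeasurable (fun x hx => ContinuousAt.continuousWithinAt ?_)
        measurableSet_Ioi
      refine (Complex.continuousAt_ofReal_cpow_const _ _ (Or.inr (ne_of_gt hx))).mul ?_
      fun_prop
    · filter_upwards [self_mem_ae_restrict measurableSet_Ioi] with x hx
      have hx' : (0 : ℝ) < x := hx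
      refine le_of_eq ?_
      simp only [F, bound, norm_mul, norm_div, norm_pow, norm_neg, norm_one, one_pow, one_mul,
        Complex.norm_cpow_eq_rpow_re_of_pos hx', Complex.norm_exp, Complex.norm_real,
        Complex.norm_natCast, Real.norm_of_nonneg hx'.le, Complex.sub_re, Complex.one_re]
      congr 3
      norm_cast
    · -- The dominating series sums to the norm of the Gaussian sine at frequency `‖b‖ i`.
      have hc := (mellinConvergent_gaussSin ha (‖b‖ * Complex.I) (s := s) hs).norm
      refine hc.congr ?_
      filter_upwards [self_mem_ae_restrict measurableSet_Ioi] with x hx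
      have hx' : (0 : ℝ) < x := hx
      rw [(hbs x).tsum_eq, norm_smul, norm_gaussSin_mul_I,
        Complex.norm_cpow_eq_rpow_re_of_pos hx', abs_of_nonneg (Real.sinh_nonneg_iff.mpr
          (by positivity))]
      simp
    · exact ae_of_all _ fun x => ((Complex.hasSum_sin (b * x)).mul_left _).mul_left _
  have hterm : ∀ k : ℕ, ∫ x in Ioi (0 : ℝ), F k x =
      b / 2 * (a : ℂ) ^ (-((s + 1) / 2)) * Complex.Gamma ((s + 1) / 2) *
      ((ascPochhammer ℂ k).eval ((s + 1) / 2) / (ascPochhammer ℂ k).eval (3 / 2 : ℂ) *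
        (-b ^ 2 / (4 * a)) ^ k / (k.factorial : ℂ)) := by
    intro k
    have hre : 0 < (s + (2 * k + 1 : ℕ)).re := by
      have : (0 : ℝ) ≤ k := k.cast_nonneg
      simp; linarith
    have h1 : ∫ x in Ioi (0 : ℝ), F k x = ((-1) ^ k * b ^ (2 * k + 1) / (2 * k + 1).factorial) *
        ∫ x in Ioi (0 : ℝ), (x : ℂ) ^ (s + (2 * k + 1 : ℕ) - 1) *
          Complex.exp (-a * (x : ℂ) ^ 2) := by
      rw [← integral_const_mul]
      refine setIntegral_congr_fun measurableSet_Ioi fun x hx => ?_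
      have hx0 : (x : ℂ) ≠ 0 := Complex.ofReal_ne_zero.mpr (ne_of_gt hx)
      simp only [F]
      rw [show s + (2 * k + 1 : ℕ) - 1 = s - 1 + (2 * k + 1 : ℕ) by ring,
        Complex.cpow_add _ _ hx0, Complex.cpow_natCast, mul_pow]
      ring
    have hg : ∀ j : ℕ, (s + 1) / 2 ≠ -j := by
      intro j h
      have := congrArg Complex.re h
      simp at this
      have hj : (0 : ℝ) ≤ j := j.cast_nonneg
      linarith
    have h2 : Complex.Gamma ((s + (2 * k + 1 : ℕ)) / 2) =
        Complex.Gamma ((s + 1) / 2) * (ascPochhammer ℂ k).eval ((s + 1) / 2) := by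
      have h := Complex.Gamma_add_nat_div_Gamma_eq (n := k) ((s + 1) / 2) hg
      rw [div_eq_iff (Complex.Gamma_ne_zero hg)] at h
      rw [show (s + (2 * k + 1 : ℕ)) / 2 = (s + 1) / 2 + k by push_cast; ring, h, mul_comm]
    have h3 : (a : ℂ) ^ (-((s + (2 * k + 1 : ℕ)) / 2)) =
        (a : ℂ) ^ (-((s + 1) / 2)) / (a : ℂ) ^ k := by
      rw [show -((s + (2 * k + 1 : ℕ)) / 2) = -((s + 1) / 2) - k by push_cast; ring,
        Complex.cpow_sub _ _ ha0, Complex.cpow_natCast]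
    rw [h1, mellin_exp_neg_mul_sq ha hre, h2, h3, factorial_two_mul_add_one]
    have h4 := ascPochhammer_eval_ne_zero three_halves_ne_neg k
    have h5 : (k.factorial : ℂ) ≠ 0 := by exact_mod_cast k.factorial_ne_zero
    rw [div_pow, neg_pow (b ^ 2), mul_pow, ← pow_mul]
    field_simp
    ring
  simp_rw [hterm] at hmain
  rw [← hmain.tsum_eq, tsum_mul_left, kummer_eq_tsum _ _ _ three_halves_ne_neg]

/-! ### The Mellin transform of `1 / (eᵗ - 1) - 1 / t` -/

theorem continuousOn_inv_exp_sub_one :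
    ContinuousOn (fun t : ℝ => 1 / (Complex.exp t - 1)) (Ioi 0) := by
  refine ContinuousOn.div (by fun_prop) (by fun_prop) fun t ht => ?_
  have ht' : (0 : ℝ) < t := ht
  have : Real.exp t - 1 ≠ 0 := by linarith [Real.add_one_lt_exp ht'.ne'] |> ne_of_gt
  exact_mod_cast this

theorem norm_inv_exp_sub_one_le {t : ℝ} (ht : 1 ≤ t) :
    ‖1 / (Complex.exp t - 1)‖ ≤ 2 * Real.exp (-1 * t) := by
  have h : 2 ≤ Real.exp t := by linarith [Real.add_one_le_exp t]
  have h1 : Complex.exp t - 1 = ((Real.exp t - 1 : ℝ) : ℂ) := by push_cast; rfl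
  rw [h1, norm_div, norm_one, Complex.norm_real, Real.norm_of_nonneg (by linarith), neg_one_mul,
    Real.exp_neg, div_le_iff₀ (by linarith)]
  field_simp
  linarith

theorem inv_exp_sub_one_isBigO_atTop :
    (fun t : ℝ => 1 / (Complex.exp t - 1)) =O[atTop] fun t => Real.exp (-1 * t) := by
  refine IsBigO.of_bound 2 ?_
  filter_upwards [eventually_ge_atTop 1] with t ht
  simpa using! norm_inv_exp_sub_one_le ht

/-- The function `1 / (eᵗ - 1) - 1 / t` is bounded near `0`. -/
theorem norm_inv_exp_sub_one_sub_inv_le {t : ℝ} (ht : 0 < t) (ht1 : t ≤ 1) :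
    ‖1 / (Complex.exp t - 1) - 1 / (t : ℂ)‖ ≤ 1 := by
  have h1 : 1 / (Complex.exp t - 1) - 1 / (t : ℂ) = ((1 / (Real.exp t - 1) - 1 / t : ℝ) : ℂ) := by
    push_cast; rfl
  have h2 : t < Real.exp t - 1 := by linarith [Real.add_one_lt_exp ht.ne']
  have h3 := Real.abs_exp_sub_one_sub_id_le (x := t) (by rwa [abs_of_pos ht])
  have h4 : 0 < Real.exp t - 1 := by linarith
  rw [h1, Complex.norm_real, div_sub_div _ _ h4.ne' ht.ne', norm_div,
    Real.norm_of_nonneg (r := (Real.exp t - 1) * t) (by positivity), div_le_one (by positivity),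
    Real.norm_eq_abs, abs_le]
  rw [abs_le] at h3
  constructor <;> nlinarith

/-- For `Re s > 1`, `∫₀^∞ t^{s-1} / (eᵗ - 1) dt = Γ(s) ζ(s)`. -/
theorem hasMellin_inv_exp_sub_one {s : ℂ} (hs : 1 < s.re) :
    HasMellin (fun t : ℝ => 1 / (Complex.exp t - 1)) s (Complex.Gamma s * riemannZeta s) := by
  constructor
  · refine mellinConvergent_of_isBigO_rpow_exp (a := 1) (b := 1) one_pos
      (continuousOn_inv_exp_sub_one.locallyIntegrableOn measurableSet_Ioi)
      inv_exp_sub_one_isBigO_atTop ?_ hs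
    refine IsBigO.of_bound 2 ?_
    filter_upwards [Ioc_mem_nhdsGT (zero_lt_one' ℝ)] with t ht
    have h := norm_inv_exp_sub_one_sub_inv_le ht.1 ht.2
    have h2 : ‖1 / (t : ℂ)‖ = t⁻¹ := by simp [abs_of_pos ht.1]
    have h3 : 1 ≤ t⁻¹ := (one_le_inv₀ ht.1).mpr ht.2
    rw [Real.rpow_neg_one, Real.norm_of_nonneg (inv_nonneg.mpr ht.1.le)]
    have h4 := norm_add_le (1 / (Complex.exp t - 1) - 1 / (t : ℂ)) (1 / (t : ℂ))
    rw [sub_add_cancel] at h4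
    linarith
  · have hF : ∀ t ∈ Ioi (0 : ℝ),
        HasSum (fun n : ℕ => (1 : ℂ) * (Real.exp (-((n : ℝ) + 1) * t) : ℂ))
          (1 / (Complex.exp t - 1)) := by
      intro t ht
      have ht' : (0 : ℝ) < t := ht
      have h1 : ‖Complex.exp (-t)‖ < 1 := by
        rw [Complex.norm_exp]; simpa using ht'
      have h2 := (hasSum_geometric_of_norm_lt_one h1).mul_left (Complex.exp (-t))
      have h3 : Complex.exp t - 1 ≠ 0 := by
        have : Real.exp t - 1 ≠ 0 := by linarith [Real.add_one_lt_exp ht'.ne'] |> ne_of_gt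
        exact_mod_cast this
      have h5 : Complex.exp (-t) * (1 - Complex.exp (-t))⁻¹ = 1 / (Complex.exp t - 1) := by
        have h6 : Complex.exp t ≠ 0 := Complex.exp_ne_zero _
        rw [Complex.exp_neg, ← one_div_one_div (Complex.exp (t : ℂ) - 1)]
        field_simp
      rw [h5] at h2
      refine h2.congr_fun ?_
      intro n
      rw [one_mul, ← Complex.exp_nat_mul, ← Complex.exp_add]
      push_cast
      congr 1
      ring
    have := hasSum_mellin (a := fun _ : ℕ => (1 : ℂ)) (p := fun n : ℕ => (n : ℝ) + 1)
      (s := s) (fun n => Or.inr (by positivity)) (by linarith) hF ?_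
    · rw [← this.tsum_eq, zeta_eq_tsum_one_div_nat_add_one_cpow hs, ← tsum_mul_left]
      refine tsum_congr fun n => ?_
      push_cast
      ring
    · have h := (summable_nat_add_iff 1).mpr (Real.summable_one_div_nat_rpow.mpr hs)
      simpa using h

/-- `1 / (eᵗ - 1)` with its pole at `0` removed by a cut-off. -/
noncomputable def truncatedBose (t : ℝ) : ℂ :=
  1 / (Complex.exp t - 1) - indicator (Ioc 0 1) (fun t : ℝ => (t : ℂ) ^ (-1 : ℂ)) t

/-- The cut-off function is bounded at `0` and decays exponentially, so its Mellin transform is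
holomorphic in the right half-plane. -/
theorem mellin_truncatedBose_regular {s : ℂ} (hs : 0 < s.re) :
    MellinConvergent truncatedBose s ∧ DifferentiableAt ℂ (mellin truncatedBose) s := by
  have hl : LocallyIntegrableOn truncatedBose (Ioi 0) := by
    refine (continuousOn_inv_exp_sub_one.locallyIntegrableOn measurableSet_Ioi).sub ?_
    have hc : ContinuousOn (fun t : ℝ => (t : ℂ) ^ (-1 : ℂ)) (Ioi 0) := fun x hx =>
      (Complex.continuousAt_ofReal_cpow_const _ _ (Or.inr (ne_of_gt hx))).continuousWithinAt
    intro x hx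
    obtain ⟨u, hu, hui⟩ := hc.locallyIntegrableOn (μ := volume) measurableSet_Ioi x hx
    exact ⟨u, hu, hui.indicator measurableSet_Ioc⟩
  have htop : truncatedBose =O[atTop] fun t => Real.exp (-1 * t) := by
    refine inv_exp_sub_one_isBigO_atTop.congr' ?_ EventuallyEq.rfl
    filter_upwards [eventually_gt_atTop 1] with t ht
    rw [truncatedBose, indicator_of_notMem (fun h => ht.not_ge h.2), sub_zero]
  have hbot : truncatedBose =O[𝓝[>] 0] (fun t : ℝ => t ^ (-(0 : ℝ))) := by
    refine IsBigO.of_bound 1 ?_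
    filter_upwards [Ioc_mem_nhdsGT (zero_lt_one' ℝ)] with t ht
    rw [truncatedBose, indicator_of_mem ht, Complex.cpow_neg_one, ← one_div]
    simpa using! norm_inv_exp_sub_one_sub_inv_le ht.1 ht.2
  exact ⟨mellinConvergent_of_isBigO_rpow_exp one_pos hl htop hbot hs,
    mellin_differentiableAt_of_isBigO_rpow_exp one_pos hl htop hbot hs⟩

/-- By analytic continuation from `Re s > 1`, the Mellin transform of the truncated function is
`Γ(s) ζ(s) - 1 / (s - 1)` in the critical strip. -/
theorem mellin_truncatedBose {s : ℂ} (hs : 0 < s.re) (hs1 : s.re < 1) :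
    mellin truncatedBose s = Complex.Gamma s * riemannZeta s - 1 / (s - 1) := by
  -- The union of three convex sets, joined through the quadrant `Re s > 0`, `Im s > 0`, connects
  -- the strip with the half-plane `Re s > 1` while avoiding the pole at `1`.
  let A : Set ℂ := {s | 1 < s.re}
  let B : Set ℂ := {s | 0 < s.re} ∩ {s | 0 < s.im}
  let C : Set ℂ := {s | 0 < s.re} ∩ {s | s.re < 1}
  have hA : IsPreconnected A := (convex_halfSpace_re_gt 1).isPreconnected
  have hB : IsPreconnected B :=
    ((convex_halfSpace_re_gt 0).inter (convex_halfSpace_im_gt 0)).isPreconnected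
  have hC : IsPreconnected C :=
    ((convex_halfSpace_re_gt 0).inter (convex_halfSpace_re_lt 1)).isPreconnected
  have hAB : IsPreconnected (A ∪ B) := hA.union' ⟨2 + Complex.I, by simp [A, B]⟩ hB
  have hU : IsPreconnected (A ∪ B ∪ C) :=
    hAB.union' ⟨1 / 2 + Complex.I, Or.inr (by norm_num [B]), by norm_num [C]⟩ hC
  have hAo : IsOpen A := isOpen_lt continuous_const Complex.continuous_re
  have hUo : IsOpen (A ∪ B ∪ C) :=
    (hAo.union ((isOpen_lt continuous_const Complex.continuous_re).inter
      (isOpen_lt continuous_const Complex.continuous_im))).union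
      ((isOpen_lt continuous_const Complex.continuous_re).inter
        (isOpen_lt Complex.continuous_re continuous_const))
  have hpos : ∀ w ∈ A ∪ B ∪ C, 0 < w.re := by
    rintro w ((h | h) | h)
    · exact one_pos.trans h
    · exact h.1
    · exact h.1
  have hne : ∀ w ∈ A ∪ B ∪ C, w ≠ 1 := by
    rintro w ((h | h) | h) rfl
    · simp [A] at h
    · simp [B] at h
    · simp [C] at h
  have hf : AnalyticOnNhd ℂ (mellin truncatedBose) (A ∪ B ∪ C) :=
    DifferentiableOn.analyticOnNhd
      (fun w hw => (mellin_truncatedBose_regular (hpos w hw)).2.differentiableWithinAt) hUo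
  have hg : AnalyticOnNhd ℂ (fun s => Complex.Gamma s * riemannZeta s - 1 / (s - 1))
      (A ∪ B ∪ C) := by
    refine DifferentiableOn.analyticOnNhd (fun w hw => DifferentiableAt.differentiableWithinAt ?_)
      hUo
    refine ((Complex.differentiableAt_Gamma w fun m h => ?_).mul
      (differentiableAt_riemannZeta (hne w hw))).sub ((differentiableAt_const _).div
        (by fun_prop) (sub_ne_zero.mpr (hne w hw)))
    have := hpos w hw
    simp only [h, Complex.neg_re, Complex.natCast_re] at this
    linarith [m.cast_nonneg (α := ℝ)]
  have h2 : (2 : ℂ) ∈ A := by simp [A]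
  refine hf.eqOn_of_preconnected_of_eventuallyEq hg hU (z₀ := 2) (Or.inl (Or.inl h2)) ?_
    (Or.inr ⟨hs, hs1⟩)
  filter_upwards [hAo.mem_nhds h2] with w hw
  have hw' : 1 < w.re := hw
  have h := (hasMellin_sub (hasMellin_inv_exp_sub_one hw').1
    (hasMellin_cpow_Ioc (-1) (s := w) (by simpa using hw')).1).2
  rw [(hasMellin_inv_exp_sub_one hw').2,
    (hasMellin_cpow_Ioc (-1) (s := w) (by simpa using hw')).2] at h
  exact h

/-- For `0 < Re s < 1`, `∫₀^∞ t^{s-1} (1 / (eᵗ - 1) - 1 / t) dt = Γ(s) ζ(s)`. -/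
theorem hasMellin_inv_exp_sub_one_sub_inv {s : ℂ} (hs : 0 < s.re) (hs1 : s.re < 1) :
    HasMellin (fun t : ℝ => 1 / (Complex.exp t - 1) - 1 / (t : ℂ)) s
      (Complex.Gamma s * riemannZeta s) := by
  have hI : HasMellin (indicator (Ioi 1) (fun t : ℝ => (t : ℂ) ^ (-1 : ℂ))) s (-1 / (s - 1)) := by
    have hsub : Ioi (1 : ℝ) ⊆ Ioi 0 := Ioi_subset_Ioi zero_le_one
    have hlt : (s - 2).re < -1 := by simp; linarith
    have e : ∀ t ∈ Ioi (1 : ℝ), (t : ℂ) ^ (s - 1) * (t : ℂ) ^ (-1 : ℂ) = (t : ℂ) ^ (s - 2) := by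
      intro t ht
      have ht0 : (t : ℂ) ≠ 0 := Complex.ofReal_ne_zero.mpr (ne_of_gt (hsub ht))
      rw [← Complex.cpow_add _ _ ht0]
      congr 1
      ring
    simp_rw [HasMellin, mellin, MellinConvergent, ← indicator_smul, IntegrableOn,
      integrable_indicator_iff measurableSet_Ioi, smul_eq_mul,
      integral_indicator measurableSet_Ioi, IntegrableOn,
      Measure.restrict_restrict_of_subset hsub]
    rw [setIntegral_congr_fun measurableSet_Ioi e, integral_Ioi_cpow_of_lt hlt one_pos]
    refine ⟨(integrableOn_Ioi_cpow_of_lt hlt one_pos).congr_fun (fun t ht => (e t ht).symm)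
      measurableSet_Ioi, ?_⟩
    rw [Complex.ofReal_one, Complex.one_cpow]
    congr 1
    ring
  have h := hasMellin_sub (mellin_truncatedBose_regular hs).1 hI.1
  rw [hI.2, mellin_truncatedBose hs hs1] at h
  have e : EqOn
      (fun t : ℝ => truncatedBose t - indicator (Ioi 1) (fun t : ℝ => (t : ℂ) ^ (-1 : ℂ)) t)
      (fun t : ℝ => 1 / (Complex.exp t - 1) - 1 / (t : ℂ)) (Ioi 0) := by
    intro t ht
    by_cases h1 : t ≤ 1
    · simp [truncatedBose, indicator_of_mem (show t ∈ Ioc 0 1 from ⟨ht, h1⟩),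
        Complex.cpow_neg_one, h1]
    · rw [not_le] at h1
      simp [truncatedBose, Complex.cpow_neg_one, h1]
  constructor
  · exact h.1.congr_fun (fun t ht => by simp only [e ht]) measurableSet_Ioi
  · rw [mellin, setIntegral_congr_fun measurableSet_Ioi (g := fun t : ℝ => (t : ℂ) ^ (s - 1) •
      (truncatedBose t - indicator (Ioi 1) (fun t : ℝ => (t : ℂ) ^ (-1 : ℂ)) t))
      (fun t ht => by simp only [← e ht])]
    refine h.2.trans ?_
    ring

/-! ### The error function as a Kummer function -/

theorem integral_exp_sq_mul (w : ℂ) :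
    ∫ u in (0 : ℝ)..1, Complex.exp ((u : ℂ) ^ 2 * w) = kummer (1 / 2) (3 / 2) w := by
  have hs : HasSum (fun n : ℕ => ∫ u in (0 : ℝ)..1, ((u : ℂ) ^ 2 * w) ^ n / (n.factorial : ℂ))
      (∫ u in (0 : ℝ)..1, Complex.exp ((u : ℂ) ^ 2 * w)) := by
    refine intervalIntegral.hasSum_integral_of_dominated_convergence
      (fun n _ => ‖w‖ ^ n / (n.factorial : ℝ)) (fun n => ?_) (fun n => ?_) ?_ ?_ ?_
    · exact Continuous.aestronglyMeasurable (by fun_prop)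
    · refine ae_of_all _ fun u hu => ?_
      rw [uIoc_of_le zero_le_one] at hu
      rw [norm_div, norm_pow, norm_mul, norm_pow, Complex.norm_natCast, Complex.norm_real,
        Real.norm_of_nonneg hu.1.le]
      have : u ^ 2 ≤ 1 := pow_le_one₀ hu.1.le hu.2
      gcongr
      exact mul_le_of_le_one_left (norm_nonneg _) this
    · exact ae_of_all _ fun _ _ => Real.summable_pow_div_factorial ‖w‖
    · exact intervalIntegrable_const
    · refine ae_of_all _ fun u _ => ?_
      rw [Complex.exp_eq_exp_ℂ]
      exact NormedSpace.expSeries_div_hasSum_exp _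
  rw [← hs.tsum_eq, kummer_eq_tsum _ _ _ three_halves_ne_neg]
  refine tsum_congr fun n => ?_
  have h1 : ∀ u : ℝ, ((u : ℂ) ^ 2 * w) ^ n / (n.factorial : ℂ) =
      (w ^ n / (n.factorial : ℂ)) * ((u ^ (2 * n) : ℝ) : ℂ) := by
    intro u; push_cast; rw [mul_pow, ← pow_mul]; ring
  simp_rw [h1]
  rw [intervalIntegral.integral_const_mul, intervalIntegral.integral_ofReal, integral_pow]
  have h2 : (ascPochhammer ℂ n).eval (1 / 2 : ℂ) * (2 * n + 1) =
      (ascPochhammer ℂ n).eval (3 / 2 : ℂ) := by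
    have h := ascPochhammer_eval_succ_left n (1 / 2 : ℂ)
    rw [ascPochhammer_succ_eval, show (1 / 2 : ℂ) + 1 = 3 / 2 by norm_num] at h
    linear_combination 2 * h
  have h3 := ascPochhammer_eval_ne_zero three_halves_ne_neg n
  have h4 : (2 * n + 1 : ℂ) ≠ 0 := by exact_mod_cast (2 * n).succ_ne_zero
  rw [← h2] at h3 ⊢
  have h5 := left_ne_zero_of_mul h3
  push_cast
  rw [one_pow, zero_pow (Nat.succ_ne_zero _), sub_zero]
  field_simp

theorem erf_eq_kummer (z : ℂ) :
    erf z = 2 / (Real.sqrt Real.pi : ℂ) * (z * kummer (1 / 2) (3 / 2) (-z ^ 2)) := by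
  rw [erf, ← integral_exp_sq_mul]
  congr 3
  ext u
  congr 1
  ring

/-! ### Fubini's theorem for Mellin transforms -/

/-- Fubini's theorem behind Parseval's formula for the Mellin transform. -/
theorem mellin_fubini {f : ℝ → ℂ} {G : ℝ → ℂ} {σ : ℝ} (hf : MellinConvergent f (1 - σ))
    (hG : Integrable G) :
    Integrable (fun y : ℝ => mellin f (1 - (σ + y * Complex.I)) * G y) ∧
    IntegrableOn (fun x : ℝ => f x * ∫ y : ℝ, (x : ℂ) ^ (-(σ + y * Complex.I)) * G y) (Ioi 0) ∧
    ∫ y : ℝ, mellin f (1 - (σ + y * Complex.I)) * G y =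
      ∫ x in Ioi (0 : ℝ), f x * ∫ y : ℝ, (x : ℂ) ^ (-(σ + y * Complex.I)) * G y := by
  have hK : Integrable (fun p : ℝ × ℝ => (p.1 : ℂ) ^ (-(σ + p.2 * Complex.I)) * f p.1 * G p.2)
      ((volume.restrict (Ioi 0)).prod volume) := by
    have h1 := Integrable.mul_prod hf hG
    have h2 : AEStronglyMeasurable (fun p : ℝ × ℝ => (p.1 : ℂ) ^ (-(p.2 * Complex.I)))
        ((volume.restrict (Ioi 0)).prod volume) :=
      Measurable.aestronglyMeasurable (by fun_prop)
    have hpos : ∀ᵐ p : ℝ × ℝ ∂((volume.restrict (Ioi 0)).prod volume), 0 < p.1 :=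
      Measure.quasiMeasurePreserving_fst.ae (ae_restrict_mem measurableSet_Ioi)
    -- The factor `x ^ (-iy)` coupling the two variables is unimodular.
    have h3 := h1.bdd_mul (c := 1) h2 ?_
    · refine h3.congr ?_
      filter_upwards [hpos] with p hp
      have hp0 : (p.1 : ℂ) ≠ 0 := Complex.ofReal_ne_zero.mpr hp.ne'
      rw [neg_add, Complex.cpow_add _ _ hp0, show (1 : ℂ) - σ - 1 = -σ by ring, smul_eq_mul]
      ring
    · filter_upwards [hpos] with p hp
      rw [Complex.norm_cpow_eq_rpow_re_of_pos hp]
      simp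
  have e1 : ∀ y : ℝ, ∫ x in Ioi (0 : ℝ), (x : ℂ) ^ (-(σ + y * Complex.I)) * f x * G y =
      mellin f (1 - (σ + y * Complex.I)) * G y := by
    intro y
    rw [integral_mul_const, mellin]
    congr 3
    ext x
    rw [smul_eq_mul]
    congr 2
    ring
  have e2 : ∀ x : ℝ, ∫ y : ℝ, (x : ℂ) ^ (-(σ + y * Complex.I)) * f x * G y =
      f x * ∫ y : ℝ, (x : ℂ) ^ (-(σ + y * Complex.I)) * G y := by
    intro x
    rw [← integral_const_mul]
    congr 1
    ext y
    ring
  refine ⟨?_, ?_, ?_⟩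
  · simpa only [e1] using hK.integral_prod_right
  · rw [IntegrableOn]
    simpa only [e2] using hK.integral_prod_left
  · simp_rw [← e1, ← e2]
    exact (integral_integral_swap hK).symm

/-! ### The two Mellin transforms on the critical line -/

/-- The function `x ↦ 1 / (e^{2πx} - 1) - 1 / (2πx)`. -/
noncomputable def boseKernel (x : ℝ) : ℂ :=
  1 / (Complex.exp (2 * Real.pi * x) - 1) - 1 / (2 * Real.pi * x)

theorem hasMellin_boseKernel {s : ℂ} (hs : 0 < s.re) (hs1 : s.re < 1) :
    HasMellin boseKernel s
      (((2 * Real.pi : ℝ) : ℂ) ^ (-s) * (Complex.Gamma s * riemannZeta s)) := by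
  have h := hasMellin_inv_exp_sub_one_sub_inv hs hs1
  have hp : 0 < 2 * Real.pi := Real.two_pi_pos
  have e : boseKernel = fun x : ℝ => (fun t : ℝ => 1 / (Complex.exp t - 1) - 1 / (t : ℂ))
      (2 * Real.pi * x) := by
    ext x; simp [boseKernel]
  rw [e]
  refine ⟨(MellinConvergent.comp_mul_left hp).mpr h.1, ?_⟩
  rw [mellin_comp_mul_left (fun t : ℝ => 1 / (Complex.exp t - 1) - 1 / (t : ℂ)) _ hp, h.2,
    smul_eq_mul]

/-- The Mellin transform of `exp (-a x²) sin (b x)` divided by `b / 2`; unlike that quotient, it is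
meaningful for `b = 0`. -/
noncomputable def gaussSinMellin (a : ℝ) (b s : ℂ) : ℂ :=
  (a : ℂ) ^ (-((s + 1) / 2)) * Complex.Gamma ((s + 1) / 2) *
    kummer ((s + 1) / 2) (3 / 2) (-b ^ 2 / (4 * a))

theorem mellin_gaussSin_eq {a : ℝ} (ha : 0 < a) (b : ℂ) {s : ℂ} (hs : -1 < s.re) :
    mellin (gaussSin a b) s = b / 2 * gaussSinMellin a b s := by
  rw [mellin_gaussSin ha b hs, gaussSinMellin]; ring

theorem kummer_zero (a c : ℂ) (hc : ∀ k : ℕ, c ≠ -k) : kummer a c 0 = 1 := by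
  rw [kummer_eq_tsum a c 0 hc, tsum_eq_single 0 (fun n hn => by simp [hn])]
  simp

theorem integrable_gaussSinMellin {a : ℝ} (ha : 0 < a) (b : ℂ) {σ : ℝ} (hσ : 0 < σ) :
    Integrable fun y : ℝ => gaussSinMellin a b (σ + y * Complex.I) := by
  rcases eq_or_ne b 0 with rfl | hb
  · -- For `b = 0` this is, up to a factor, the Mellin transform of `x exp (-a x²)`.
    have h := (verticalIntegrable_mellin_gaussExp ha 0 (σ := σ + 1) (by linarith)).const_mul 2
    refine h.congr (ae_of_all _ fun y => ?_)
    have hm := mellin_exp_neg_mul_sq ha (s := ((σ + 1 : ℝ) : ℂ) + y * Complex.I)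
      (by simp; linarith)
    simp only [gaussSinMellin, mellin, gaussExp, smul_eq_mul, zero_mul, add_zero, hm]
    rw [zero_pow two_ne_zero, neg_zero, zero_div, kummer_zero _ _ three_halves_ne_neg,
      show (((σ + 1 : ℝ) : ℂ) + y * Complex.I) = σ + y * Complex.I + 1 by push_cast; ring]
    ring
  · refine ((verticalIntegrable_mellin_gaussSin ha b hσ).const_mul (2 / b)).congr
      (ae_of_all _ fun y => ?_)
    simp only [mellin_gaussSin_eq ha b (s := σ + y * Complex.I) (by simp; linarith)]
    field_simp

/-- The value of the Mellin transform at `0` is an error function. -/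
theorem integral_gaussSin_div {a : ℝ} (ha : 0 < a) (b : ℂ) :
    IntegrableOn (fun x : ℝ => gaussSin a b x / x) (Ioi 0) ∧
    ∫ x in Ioi (0 : ℝ), gaussSin a b x / x =
      Real.pi / 2 * erf (b / (2 * (Real.sqrt a : ℂ))) := by
  have hc := mellinConvergent_gaussSin ha b (s := 0) (by simp)
  have hm := mellin_gaussSin ha b (s := 0) (by simp)
  have e : ∀ x : ℝ, (x : ℂ) ^ ((0 : ℂ) - 1) • gaussSin a b x = gaussSin a b x / x := by
    intro x
    rw [zero_sub, Complex.cpow_neg_one, smul_eq_mul, div_eq_inv_mul]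
  simp only [MellinConvergent, mellin, e] at hc hm
  refine ⟨hc, ?_⟩
  have hsa : (Real.sqrt a : ℂ) ≠ 0 := by exact_mod_cast (Real.sqrt_pos.mpr ha).ne'
  have hsp : (Real.sqrt Real.pi : ℂ) ≠ 0 := by exact_mod_cast (Real.sqrt_pos.mpr Real.pi_pos).ne'
  have hsa2 : (Real.sqrt a : ℂ) ^ 2 = a := by exact_mod_cast Real.sq_sqrt ha.le
  have hsp2 : (Real.sqrt Real.pi : ℂ) ^ 2 = Real.pi := by exact_mod_cast Real.sq_sqrt Real.pi_pos.le
  have h1 : (a : ℂ) ^ (-(1 / 2 : ℂ)) = (Real.sqrt a : ℂ)⁻¹ := by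
    rw [Complex.cpow_neg, Real.sqrt_eq_rpow, Complex.ofReal_cpow ha.le]
    simp
  have h2 : Complex.Gamma (1 / 2) = (Real.sqrt Real.pi : ℂ) := by
    rw [Complex.Gamma_one_half_eq, Real.sqrt_eq_rpow, Complex.ofReal_cpow Real.pi_pos.le]
    simp
  rw [hm, zero_add, h1, h2, erf_eq_kummer, show -(b / (2 * (Real.sqrt a : ℂ))) ^ 2 =
    -b ^ 2 / (4 * a) by rw [← hsa2]; field_simp; norm_num, ← hsp2]
  field_simp

/-! ### The integrand in terms of `Ξ` -/

theorem xi_eq_completedRiemannZeta {s : ℂ} (hs : 0 < s.re) :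
    xi s = 1 / 2 * s * (s - 1) * completedRiemannZeta s := by
  have hs0 : s ≠ 0 := by rintro rfl; simp at hs
  have hG : Complex.Gammaℝ s ≠ 0 := Complex.Gammaℝ_ne_zero_of_re_pos hs
  rw [xi, riemannZeta_def_of_ne_zero hs0, mul_assoc _ _ (Complex.Gamma (s / 2)),
    ← Complex.Gammaℝ_def, mul_assoc _ (Complex.Gammaℝ s), mul_div_cancel₀ _ hG]

theorem xi_one_sub {s : ℂ} (hs : 0 < s.re) (hs1 : s.re < 1) : xi (1 - s) = xi s := by
  rw [xi_eq_completedRiemannZeta hs, xi_eq_completedRiemannZeta (s := 1 - s) (by simpa),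
    completedRiemannZeta_one_sub]
  ring

theorem Xi_neg (t : ℝ) : Xi (-t) = Xi t := by
  have h := xi_one_sub (s := 1 / 2 + Complex.I * t) (by norm_num) (by norm_num)
  rw [Xi, Xi, ← h]
  congr 1
  push_cast
  ring

/-- The Mellin transform of the Bose kernel at `1 - s` in terms of `ξ(s)`, by the functional
equation of `ζ` and the duplication formula. -/
theorem mul_mellin_boseKernel_one_sub {s : ℂ} (hs : 0 < s.re) (hs1 : s.re < 1) :
    s * (s - 1) * mellin boseKernel (1 - s) =
      (Real.pi : ℂ) ^ (s / 2 - 1) * Complex.Gamma (1 - s / 2) * xi s := by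
  have hpi : (Real.pi : ℂ) ≠ 0 := by exact_mod_cast Real.pi_ne_zero
  have h1s : 0 < (1 - s).re := by simpa
  rw [(hasMellin_boseKernel (s := 1 - s) h1s (by simpa)).2, ← xi_one_sub hs hs1, xi]
  have hdup := Complex.Gamma_mul_Gamma_add_half ((1 - s) / 2)
  rw [show (1 - s) / 2 + 1 / 2 = 1 - s / 2 by ring, show 2 * ((1 - s) / 2) = 1 - s by ring,
    show 1 - (1 - s) = s by ring] at hdup
  have hsq : (Real.sqrt Real.pi : ℂ) = (Real.pi : ℂ) ^ (1 / 2 : ℂ) := by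
    rw [Real.sqrt_eq_rpow, Complex.ofReal_cpow Real.pi_pos.le]
    simp
  have hpow : (Real.pi : ℂ) ^ (s / 2 - 1) * (Real.pi : ℂ) ^ (-(1 - s) / 2) *
      (Real.pi : ℂ) ^ (1 / 2 : ℂ) = (Real.pi : ℂ) ^ (-(1 - s)) := by
    rw [← Complex.cpow_add _ _ hpi, ← Complex.cpow_add _ _ hpi]
    congr 1
    ring
  have h2 : (2 : ℂ) ^ s = 2 * 2 ^ (-(1 - s)) := by
    rw [show -(1 - s) = s - 1 by ring, Complex.cpow_sub _ _ two_ne_zero, Complex.cpow_one]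
    ring
  have h2p : (((2 * Real.pi : ℝ) : ℂ)) ^ (-(1 - s)) =
      2 ^ (-(1 - s)) * (Real.pi : ℂ) ^ (-(1 - s)) := by
    rw [Complex.ofReal_mul, Complex.mul_cpow_ofReal_nonneg zero_le_two Real.pi_pos.le,
      Complex.ofReal_ofNat]
  rw [h2p, ← hpow, ← hsq]
  rw [h2] at hdup
  linear_combination (-(1 / 2) * s * (s - 1) * riemannZeta (1 - s) *
    (Real.pi : ℂ) ^ (s / 2 - 1) * (Real.pi : ℂ) ^ (-(1 - s) / 2)) * hdup

/-- One of the two summands of the integrand of the third integral, on the whole real line. -/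
noncomputable def halfXiIntegrand (α : ℝ) (z : ℂ) (t : ℝ) : ℂ :=
  Complex.Gamma ((-1 + Complex.I * t) / 4) * Complex.Gamma ((-1 - Complex.I * t) / 4) *
    Xi (t / 2) * omega α z ((1 + Complex.I * t) / 2)

theorem xiIntegrand_eq (α : ℝ) (z : ℂ) (t : ℝ) :
    xiIntegrand α z t = halfXiIntegrand α z t + halfXiIntegrand α z (-t) := by
  have hX : Xi (-t / 2) = Xi (t / 2) := by rw [neg_div, Xi_neg]
  simp only [xiIntegrand, halfXiIntegrand, Delta, hX]
  rw [show 1 - (1 + Complex.I * t) / 2 = (1 + Complex.I * ((-t : ℝ) : ℂ)) / 2 by push_cast; ring,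
    show (-1 + Complex.I * ((-t : ℝ) : ℂ)) / 4 = (-1 - Complex.I * t) / 4 by push_cast; ring,
    show (-1 - Complex.I * ((-t : ℝ) : ℂ)) / 4 = (-1 + Complex.I * t) / 4 by push_cast; ring]
  ring

/-- The integrand of the third integral is, up to a constant, a product of two Mellin transforms. -/
theorem halfXiIntegrand_eq {α : ℝ} (hα : 0 < α) (z : ℂ) (y : ℝ) :
    halfXiIntegrand α z (2 * y) =
      -4 * Real.pi * Real.sqrt Real.pi * α * Real.sqrt α * Complex.exp (z ^ 2 / 8) *
      (mellin boseKernel (1 - (((1 / 2 : ℝ) : ℂ) + y * Complex.I)) *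
        gaussSinMellin (Real.pi * α ^ 2) (Real.sqrt Real.pi * α * z)
          (((1 / 2 : ℝ) : ℂ) + y * Complex.I)) := by
  set s : ℂ := ((1 / 2 : ℝ) : ℂ) + y * Complex.I with hs
  have hre : s.re = 1 / 2 := by simp [hs]
  have hs0 : s ≠ 0 := by intro h; rw [h] at hre; norm_num at hre
  have hs1 : s - 1 ≠ 0 := by
    intro h; have := congrArg Complex.re h; simp [hre] at this; norm_num at this
  have hpi : (Real.pi : ℂ) ≠ 0 := by exact_mod_cast Real.pi_ne_zero
  have hα0 : (α : ℂ) ≠ 0 := by exact_mod_cast hα.ne'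
  have hM := mul_mellin_boseKernel_one_sub (s := s) (by rw [hre]; norm_num) (by rw [hre]; norm_num)
  have hsp2 : (Real.sqrt Real.pi : ℂ) ^ 2 = Real.pi := by exact_mod_cast Real.sq_sqrt Real.pi_pos.le
  have hsqp : (Real.sqrt Real.pi : ℂ) = (Real.pi : ℂ) ^ (1 / 2 : ℂ) := by
    rw [Real.sqrt_eq_rpow, Complex.ofReal_cpow Real.pi_pos.le]
    simp
  have hsqα : (Real.sqrt α : ℂ) = (α : ℂ) ^ (1 / 2 : ℂ) := by
    rw [Real.sqrt_eq_rpow, Complex.ofReal_cpow hα.le]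
    simp
  have hG1 : Complex.Gamma ((s + 1) / 2) = (s - 1) / 2 * Complex.Gamma ((s - 1) / 2) := by
    rw [← Complex.Gamma_add_one _ (div_ne_zero hs1 two_ne_zero)]
    congr 1
    ring
  have hG2 : Complex.Gamma (1 - s / 2) = -s / 2 * Complex.Gamma (-s / 2) := by
    rw [← Complex.Gamma_add_one _ (div_ne_zero (neg_ne_zero.mpr hs0) two_ne_zero)]
    congr 1
    ring
  have hK : kummer ((s + 1) / 2) (3 / 2) (-(z ^ 2 / 4)) =
      Complex.exp (-(z ^ 2 / 4)) * kummer (1 - s / 2) (3 / 2) (z ^ 2 / 4) := by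
    rw [exp_neg_mul_kummer _ _ _ three_halves_ne_neg]
    congr 1
    ring
  have harg : -((Real.sqrt Real.pi : ℂ) * α * z) ^ 2 / (4 * ((Real.pi * α ^ 2 : ℝ) : ℂ)) =
      -(z ^ 2 / 4) := by
    push_cast
    rw [mul_pow, mul_pow, hsp2]
    field_simp
  have hexp : Complex.exp (z ^ 2 / 8) * Complex.exp (-(z ^ 2 / 4)) = Complex.exp (-z ^ 2 / 8) := by
    rw [← Complex.exp_add]
    congr 1
    ring
  have hpow : ((Real.pi * α ^ 2 : ℝ) : ℂ) ^ (-((s + 1) / 2)) =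
      (Real.pi : ℂ) ^ (-((s + 1) / 2)) * (α : ℂ) ^ (-(s + 1)) := by
    rw [Complex.ofReal_mul, Complex.mul_cpow_ofReal_nonneg Real.pi_pos.le (by positivity),
      sq, Complex.ofReal_mul, Complex.mul_cpow_ofReal_nonneg hα.le hα.le,
      ← Complex.cpow_add _ _ hα0]
    congr 2
    ring
  have hpowα : (α : ℂ) * Real.sqrt α * (α : ℂ) ^ (-(s + 1)) = (α : ℂ) ^ (1 / 2 - s) := by
    nth_rewrite 1 [← Complex.cpow_one (α : ℂ)]
    rw [hsqα, ← Complex.cpow_add _ _ hα0, ← Complex.cpow_add _ _ hα0]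
    congr 1
    ring
  have hpowπ : (Real.pi : ℂ) * Real.sqrt Real.pi * (Real.pi : ℂ) ^ (-((s + 1) / 2)) *
      (Real.pi : ℂ) ^ (s / 2 - 1) = 1 := by
    nth_rewrite 1 [← Complex.cpow_one (Real.pi : ℂ)]
    rw [hsqp, ← Complex.cpow_add _ _ hpi, ← Complex.cpow_add _ _ hpi, ← Complex.cpow_add _ _ hpi,
      show (1 : ℂ) + 1 / 2 + -((s + 1) / 2) + (s / 2 - 1) = 0 by ring, Complex.cpow_zero]
  have hleft : halfXiIntegrand α z (2 * y) = Complex.Gamma ((s - 1) / 2) * Complex.Gamma (-s / 2) *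
      xi s * ((α : ℂ) ^ (1 / 2 - s) * Complex.exp (-z ^ 2 / 8) *
        kummer (1 - s / 2) (3 / 2) (z ^ 2 / 4)) := by
    rw [halfXiIntegrand, Xi, omega]
    have e1 : (-1 + Complex.I * ((2 * y : ℝ) : ℂ)) / 4 = (s - 1) / 2 := by
      rw [hs]; push_cast; ring
    have e2 : (-1 - Complex.I * ((2 * y : ℝ) : ℂ)) / 4 = -s / 2 := by
      rw [hs]; push_cast; ring
    have e3 : (1 + Complex.I * ((2 * y : ℝ) : ℂ)) / 2 = s := by
      rw [hs]; push_cast; ring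
    have e4 : 1 / 2 + Complex.I * ((2 * y / 2 : ℝ) : ℂ) = s := by
      rw [hs]; push_cast; ring
    rw [e1, e2, e3, e4]
  rw [hleft, gaussSinMellin, harg, hK, hpow, hG1]
  rw [hG2] at hM
  have hM' : (s - 1) * mellin boseKernel (1 - s) =
      (Real.pi : ℂ) ^ (s / 2 - 1) * (-1 / 2 * Complex.Gamma (-s / 2)) * xi s := by
    refine mul_left_cancel₀ hs0 ?_
    linear_combination hM
  rw [← hexp, ← hpowα]
  linear_combination (2 * Real.pi * Real.sqrt Real.pi * α * Real.sqrt α *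
    Complex.exp (z ^ 2 / 8) * (Real.pi : ℂ) ^ (-((s + 1) / 2)) * (α : ℂ) ^ (-(s + 1)) *
    Complex.Gamma ((s - 1) / 2) * Complex.exp (-(z ^ 2 / 4)) *
    kummer (1 - s / 2) (3 / 2) (z ^ 2 / 4)) * hM' -
    (α * Real.sqrt α * (α : ℂ) ^ (-(s + 1)) * Complex.Gamma ((s - 1) / 2) *
      Complex.Gamma (-s / 2) * xi s * Complex.exp (z ^ 2 / 8) * Complex.exp (-(z ^ 2 / 4)) *
      kummer (1 - s / 2) (3 / 2) (z ^ 2 / 4)) * hpowπ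

/-! ### The identity between the first and the third expression -/

/-- Parseval's formula for the Mellin transform, applied to the Bose kernel and the Gaussian
sine. -/
theorem sinIntegrand_identity {α : ℝ} (hα : 0 < α) (z : ℂ) :
    IntegrableOn (sinIntegrand α z) (Ioi 0) ∧ IntegrableOn (xiIntegrand α z) (Ioi 0) ∧
    (Real.sqrt α : ℂ) * Complex.exp (z ^ 2 / 8) *
        (erf (z / 2) - 4 * ∫ x in Ioi (0 : ℝ), sinIntegrand α z x) =
      z / (8 * (Real.pi : ℂ) ^ 2) * ∫ t in Ioi (0 : ℝ), xiIntegrand α z t := by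
  set a : ℝ := Real.pi * α ^ 2 with ha_def
  set b : ℂ := Real.sqrt Real.pi * α * z with hb_def
  have ha : 0 < a := by positivity
  have hpi : (Real.pi : ℂ) ≠ 0 := by exact_mod_cast Real.pi_ne_zero
  have hα0 : (α : ℂ) ≠ 0 := by exact_mod_cast hα.ne'
  have hsp : (Real.sqrt Real.pi : ℂ) ≠ 0 := by exact_mod_cast (Real.sqrt_pos.mpr Real.pi_pos).ne'
  have hsp2 : (Real.sqrt Real.pi : ℂ) ^ 2 = Real.pi := by exact_mod_cast Real.sq_sqrt Real.pi_pos.le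
  obtain ⟨hK, hx, hKx⟩ := mellin_fubini (f := boseKernel)
    (G := fun y : ℝ => gaussSinMellin a b (((1 / 2 : ℝ) : ℂ) + y * Complex.I)) (σ := 1 / 2)
    (hasMellin_boseKernel (s := 1 - ((1 / 2 : ℝ) : ℂ)) (by norm_num) (by norm_num)).1
    (integrable_gaussSinMellin ha b (by norm_num))
  set K : ℝ → ℂ := fun y => mellin boseKernel (1 - (((1 / 2 : ℝ) : ℂ) + y * Complex.I)) *
    gaussSinMellin a b (((1 / 2 : ℝ) : ℂ) + y * Complex.I) with hK_def
  set D : ℂ := -4 * Real.pi * Real.sqrt Real.pi * α * Real.sqrt α * Complex.exp (z ^ 2 / 8) with hD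
  -- The third integral, unfolded over the whole real line.
  have hP : halfXiIntegrand α z = fun t => D * K (t / 2) := by
    ext t
    have h := halfXiIntegrand_eq hα z (t / 2)
    rw [mul_div_cancel₀ t two_ne_zero] at h
    exact h
  have hPi : Integrable (halfXiIntegrand α z) := by
    rw [hP]
    exact (hK.comp_div two_ne_zero).const_mul D
  have hPn : Integrable fun t => halfXiIntegrand α z (-t) := hPi.comp_neg
  have hxi : xiIntegrand α z = fun t => halfXiIntegrand α z t + halfXiIntegrand α z (-t) :=
    funext (xiIntegrand_eq α z)
  have hxint : ∫ t in Ioi (0 : ℝ), xiIntegrand α z t = 2 * D * ∫ y, K y := by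
    rw [hxi, integral_add hPi.integrableOn hPn.integrableOn,
      integral_comp_neg_Ioi 0 (halfXiIntegrand α z), neg_zero, add_comm,
      intervalIntegral.integral_Iic_add_Ioi hPi.integrableOn hPi.integrableOn, hP,
      integral_const_mul, Measure.integral_comp_div K 2]
    simp
    ring
  -- Mellin inversion for the Gaussian sine.
  have hinv : ∀ x ∈ Ioi (0 : ℝ), boseKernel x * (∫ y : ℝ,
      (x : ℂ) ^ (-(((1 / 2 : ℝ) : ℂ) + y * Complex.I)) *
        gaussSinMellin a b (((1 / 2 : ℝ) : ℂ) + y * Complex.I)) * (b / (4 * Real.pi)) =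
      boseKernel x * gaussSin a b x := by
    intro x hx
    have h := mellinInv_mellin_eq (1 / 2) (gaussSin a b) hx
      (mellinConvergent_gaussSin ha b (by norm_num))
      (verticalIntegrable_mellin_gaussSin ha b (by norm_num))
      (continuous_gaussSin a b).continuousAt
    rw [← h, mellinInv, mul_assoc, ← integral_mul_const]
    congr 1
    rw [← integral_smul]
    congr 1
    ext y
    rw [mellin_gaussSin_eq ha b (s := ((1 / 2 : ℝ) : ℂ) + y * Complex.I) (by norm_num),
      smul_eq_mul, Complex.real_smul]
    push_cast
    field_simp
    ring
  have hbg : IntegrableOn (fun x => boseKernel x * gaussSin a b x) (Ioi 0) :=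
    IntegrableOn.congr_fun (hx.mul_const (b / (4 * Real.pi))) hinv measurableSet_Ioi
  have hbgi : ∫ x in Ioi (0 : ℝ), boseKernel x * gaussSin a b x =
      (∫ y, K y) * (b / (4 * Real.pi)) := by
    rw [← setIntegral_congr_fun measurableSet_Ioi hinv, integral_mul_const, ← hKx]
  obtain ⟨hdi, hd⟩ := integral_gaussSin_div ha b
  have hsin : sinIntegrand α z = fun x => boseKernel x * gaussSin a b x +
      1 / (2 * Real.pi) * (gaussSin a b x / x) := by
    ext x
    rw [sinIntegrand, boseKernel, gaussSin,
      show -(Real.pi : ℂ) * α ^ 2 * (x : ℂ) ^ 2 = -(a : ℂ) * (x : ℂ) ^ 2 by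
        rw [ha_def]; push_cast; ring,
      show (Real.sqrt Real.pi : ℂ) * α * x * z = b * x by rw [hb_def]; ring]
    ring
  have hra : (Real.sqrt a : ℂ) = Real.sqrt Real.pi * α := by
    rw [ha_def, Real.sqrt_mul Real.pi_pos.le, Real.sqrt_sq hα.le, Complex.ofReal_mul]
  have hbz : b / (2 * (Real.sqrt a : ℂ)) = z / 2 := by
    rw [hra, hb_def]
    field_simp
  rw [hbz] at hd
  refine ⟨?_, ?_, ?_⟩
  · rw [hsin]
    exact hbg.add (hdi.const_mul _)
  · rw [hxi]
    exact hPi.integrableOn.add hPn.integrableOn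
  · rw [hxint, hsin, integral_add hbg (hdi.const_mul _), integral_const_mul, hd, hbgi, hb_def, hD]
    field_simp
    ring

/-! ### The symmetry `(α, z) ↦ (1 / α, iz)` -/

theorem sinhIntegrand_eq (β : ℝ) (z : ℂ) (x : ℝ) :
    sinhIntegrand β z x = -Complex.I * sinIntegrand β (Complex.I * z) x := by
  rw [sinhIntegrand, sinIntegrand,
    show (Real.sqrt Real.pi : ℂ) * β * x * (Complex.I * z) =
      (Real.sqrt Real.pi * β * x * z) * Complex.I by ring, Complex.sin_mul_I]
  linear_combination (Complex.exp (-Real.pi * β ^ 2 * x ^ 2) *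
    Complex.sinh (Real.sqrt Real.pi * β * x * z) / (Complex.exp (2 * Real.pi * x) - 1)) *
    Complex.I_sq

theorem erfi_eq_erf (z : ℂ) : erfi z = -Complex.I * erf (Complex.I * z) := by
  rw [erfi, erf]
  have h : ∀ u : ℝ, -((u : ℂ) * (Complex.I * z)) ^ 2 = ((u : ℂ) * z) ^ 2 := fun u => by
    linear_combination (-(u : ℂ) ^ 2 * z ^ 2) * Complex.I_sq
  simp_rw [h]
  linear_combination (2 / (Real.sqrt Real.pi : ℂ) * (z * ∫ u in (0 : ℝ)..1,
    Complex.exp (((u : ℂ) * z) ^ 2))) * Complex.I_sq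

/-- Kummer's transformation exchanges the two summands of `Δ` under `α ↦ 1 / α`, `z ↦ iz`. -/
theorem omega_I_mul {α β : ℝ} (hβ : 0 < β) (hαβ : α * β = 1) (z s : ℂ) :
    omega β (Complex.I * z) s = omega α z (1 - s) := by
  have hα : α = β⁻¹ := eq_inv_of_mul_eq_one_left hαβ
  have hI : (Complex.I * z) ^ 2 = -z ^ 2 := by rw [mul_pow, Complex.I_sq]; ring
  have h1 : (α : ℂ) ^ (1 / 2 - (1 - s)) = (β : ℂ) ^ (1 / 2 - s) := by
    rw [hα, Complex.ofReal_inv, Complex.inv_cpow _ _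
      (by simp [Complex.arg_ofReal_of_nonneg hβ.le, Real.pi_ne_zero.symm]), ← Complex.cpow_neg]
    congr 1
    ring
  have h2 := exp_neg_mul_kummer (1 - (1 - s) / 2) (3 / 2) (z ^ 2 / 4) three_halves_ne_neg
  rw [show (3 / 2 : ℂ) - (1 - (1 - s) / 2) = 1 - s / 2 by ring] at h2
  rw [omega, omega, hI, h1, neg_div (4 : ℂ), ← h2, neg_neg, ← mul_assoc, mul_assoc (_ ^ _),
    ← Complex.exp_add]
  congr 3
  ring

theorem xiIntegrand_I_mul {α β : ℝ} (hβ : 0 < β) (hαβ : α * β = 1) (z : ℂ) :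
    xiIntegrand β (Complex.I * z) = xiIntegrand α z := by
  ext t
  rw [xiIntegrand, xiIntegrand, Delta, Delta, omega_I_mul hβ hαβ, omega_I_mul hβ hαβ,
    sub_sub_cancel, add_comm (omega α z _)]

end ErfTransformation

theorem theorem1p1 (z : ℂ) (α β : ℝ) (hα : 0 < α) (hβ : 0 < β) (hαβ : α * β = 1) :
    IntegrableOn (ErfTransformation.sinIntegrand α z) (Ioi 0) ∧
    IntegrableOn (ErfTransformation.sinhIntegrand β z) (Ioi 0) ∧
    IntegrableOn (ErfTransformation.xiIntegrand α z) (Ioi 0) ∧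
    (Real.sqrt α : ℂ) * Complex.exp (z ^ 2 / 8) *
        (ErfTransformation.erf (z / 2) -
          4 * ∫ x in Ioi (0 : ℝ), ErfTransformation.sinIntegrand α z x) =
      (Real.sqrt β : ℂ) * Complex.exp (-z ^ 2 / 8) *
        (ErfTransformation.erfi (z / 2) -
          4 * ∫ x in Ioi (0 : ℝ), ErfTransformation.sinhIntegrand β z x) ∧
    (Real.sqrt β : ℂ) * Complex.exp (-z ^ 2 / 8) *
        (ErfTransformation.erfi (z / 2) -
          4 * ∫ x in Ioi (0 : ℝ), ErfTransformation.sinhIntegrand β z x) =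
      z / (8 * (Real.pi : ℂ) ^ 2) *
        ∫ t in Ioi (0 : ℝ), ErfTransformation.xiIntegrand α z t := by
  obtain ⟨h1, h2, h3⟩ := ErfTransformation.sinIntegrand_identity hα z
  obtain ⟨k1, _, k3⟩ := ErfTransformation.sinIntegrand_identity hβ (Complex.I * z)
  have hsinh : ErfTransformation.sinhIntegrand β z =
      fun x => -Complex.I * ErfTransformation.sinIntegrand β (Complex.I * z) x :=
    funext (ErfTransformation.sinhIntegrand_eq β z)
  have key : (Real.sqrt β : ℂ) * Complex.exp (-z ^ 2 / 8) *
        (ErfTransformation.erfi (z / 2) -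
          4 * ∫ x in Ioi (0 : ℝ), ErfTransformation.sinhIntegrand β z x) =
      z / (8 * (Real.pi : ℂ) ^ 2) *
        ∫ t in Ioi (0 : ℝ), ErfTransformation.xiIntegrand α z t := by
    rw [ErfTransformation.xiIntegrand_I_mul hβ hαβ, mul_pow, Complex.I_sq, neg_one_mul] at k3
    rw [hsinh, integral_const_mul, ErfTransformation.erfi_eq_erf, ← mul_div_assoc]
    linear_combination (-Complex.I) * k3 - z / (8 * (Real.pi : ℂ) ^ 2) *
      (∫ t in Ioi (0 : ℝ), ErfTransformation.xiIntegrand α z t) * Complex.I_sq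
  refine ⟨h1, ?_, h2, h3.trans key.symm, key⟩
  rw [hsinh]
  exact k1.const_mul _
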